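/- A convex polygon in $\mathbb{R}^3$ is the convex hull of finitely many points of $\mathbb{R}^3$ whose affine span is a plane; its sides are its one-dimensional faces. A side-contact representation of a graph $G=(V,E)$ with convex polygons in 3D assigns to every vertex $v$ a convex polygon $P_v\subset\mathbb{R}^3$ such that the polygons have pairwise disjoint relative interiors, two distinct vertices $u,v$ are adjacent in $G$ if and only if $P_u$ and $P_v$ have an entire side in common, and no segment is a side of more than two of the polygons. There is an absolute constant $C>0$ such that every finite simple graph with $n$ vertices that has a side-contact representation with convex polygons in 3D has at most $C\,n^{5/3}$ edges. -/

import Mathlib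

namespace SideContact

/-- Euclidean 3-space. -/
abbrev E3 : Type := EuclideanSpace ℝ (Fin 3)

/-- A (closed, filled) convex polygon in 3-space: the convex hull of finitely many points that
spans a plane. -/
def IsConvexPolygon (P : Set E3) : Prop :=
  (∃ S : Set E3, S.Finite ∧ P = convexHull ℝ S) ∧ Module.finrank ℝ (vectorSpan ℝ P) = 2

/-- `s` is a side of the polygon `P`: a nondegenerate segment that is a face of `P`, i.e. the
set of all points of `P` at which some linear functional attains its maximum over `P`.
Hence a side is always a whole side, from corner to corner. -/
def IsSide (s P : Set E3) : Prop :=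
  (∃ a b : E3, a ≠ b ∧ s = segment ℝ a b) ∧ IsExposed ℝ P s

/-- Two polygons have a side-contact if they have a full side in common. -/
def SidesTouch (P Q : Set E3) : Prop :=
  ∃ s : Set E3, IsSide s P ∧ IsSide s Q

/-- `P` is a side-contact representation of `G` with convex polygons in 3-space. The vertices
correspond bijectively to the polygons `P v`: these are pairwise distinct, since their relative
interiors are nonempty and pairwise disjoint. -/
structure IsSideContactRep {V : Type*} (G : SimpleGraph V) (P : V → Set E3) : Prop where
  convexPolygon : ∀ v, IsConvexPolygon (P v)
  interiorDisjoint : ∀ u v, u ≠ v →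
    Disjoint (intrinsicInterior ℝ (P u)) (intrinsicInterior ℝ (P v))
  adj_iff : ∀ u v, u ≠ v → (G.Adj u v ↔ SidesTouch (P u) (P v))
  side_le_two : ∀ s : Set E3, {v | IsSide s (P v)}.encard ≤ 2

/-- `G` has a side-contact representation with convex polygons in 3-space. -/
def HasSideContactRep {V : Type*} (G : SimpleGraph V) : Prop :=
  ∃ P : V → Set E3, IsSideContactRep G P

end SideContact

/-!
The contacts are split into those between polygons in different planes and those between polygons
in a common plane.

For the first kind, no three polygons `A`, `B`, `C` ("bodies") have `129` common neighbours ("plates").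
If a body and a plate in different planes share a side, then each lies on one side of the plane of
the other, because the line of the common side supports both polygons. By the pigeonhole principle
three plates have the same six signs. Let `g 0`, `g 1`, `g 2` be affine functionals vanishing on their
planes and `f 0`, `f 1`, `f 2` functionals vanishing on the planes of the bodies. Affine functionals on
3-space form a 4-dimensional space, in which each `f X` is nonzero modulo the span of the `g i`, and
evaluating linear relations at the midpoints of the common sides determines the sign of the ratio of
any two of the `f X` modulo that span (`coeff_eq_zero_of_relation`). The three signs contradict each
other (`false_of_three_plates`). A graph in which every three vertices have a bounded number of
common neighbours has `O(n ^ (5 / 3))` edges (`card_edgeFinset_cube_le`).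

For the second kind there are at most `3 * n` contacts. All planes are mapped injectively to the
coordinate plane, such that no common side becomes vertical, and each image is swept by a vertical
line. Two polygons with a common side are consecutive on some position of the line, and a sweep
creates at most three consecutive pairs per polygon (`ncard_isConsecutive_le`).
-/

namespace SideContact

/-! ### A Kővári–Sós–Turán bound -/

open Finset in
/-- If any three distinct vertices have at most `k` common neighbours, the graph has `O(n ^ (5 / 3))`
edges: the cubes of the degrees count the pairs of a vertex and an ordered triple of its
neighbours. -/
theorem card_edgeFinset_cube_le {V : Type*} [Fintype V] [DecidableEq V] (H : SimpleGraph V)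
    [DecidableRel H.Adj] (k : ℕ)
    (h : ∀ x y z : V, x ≠ y → x ≠ z → y ≠ z → #{v | H.Adj x v ∧ H.Adj y v ∧ H.Adj z v} ≤ k) :
    (2 * #H.edgeFinset) ^ 3 ≤ (k + 3) * Fintype.card V ^ 5 := by
  set n := Fintype.card V with hn
  have hcube : ∑ v, H.degree v ^ 3 ≤ (k + 3) * n ^ 3 := by
    have hswap : ∑ v, H.degree v ^ 3
        = ∑ x, ∑ y, ∑ z, #{v | H.Adj x v ∧ H.Adj y v ∧ H.Adj z v} := by
      have hdeg : ∀ v, H.degree v = ∑ x, if H.Adj x v then 1 else 0 := by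
        intro v
        rw [← H.card_neighborFinset_eq_degree, H.neighborFinset_eq_filter, card_filter]
        simp only [H.adj_comm]
      have hd3 : ∀ v, H.degree v ^ 3
          = ∑ x, ∑ y, ∑ z, if H.Adj x v ∧ H.Adj y v ∧ H.Adj z v then 1 else 0 := by
        intro v
        rw [hdeg, pow_succ, sq, sum_mul_sum, sum_mul]
        refine sum_congr rfl fun x _ => ?_
        rw [sum_mul_sum]
        refine sum_congr rfl fun y _ => sum_congr rfl fun z _ => ?_
        by_cases hx : H.Adj x v <;> by_cases hy : H.Adj y v <;> simp [hx, hy]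
      simp only [hd3, card_filter]
      rw [sum_comm]
      refine sum_congr rfl fun x _ => ?_
      rw [sum_comm]
      refine sum_congr rfl fun y _ => ?_
      rw [sum_comm]
    rw [hswap]
    -- triples with a repetition contribute at most `n` each, and there are at most `3 * n ^ 2` of them
    have hpt : ∀ x y z : V, #{v | H.Adj x v ∧ H.Adj y v ∧ H.Adj z v}
        ≤ k + ((if x = y then n else 0) + (if x = z then n else 0) + if y = z then n else 0) := by
      intro x y z
      have hle : #{v | H.Adj x v ∧ H.Adj y v ∧ H.Adj z v} ≤ n := card_le_univ _
      by_cases hxy : x = y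
      · have : (if x = y then n else 0) = n := if_pos hxy
        omega
      by_cases hxz : x = z
      · have : (if x = z then n else 0) = n := if_pos hxz
        omega
      by_cases hyz : y = z
      · have : (if y = z then n else 0) = n := if_pos hyz
        omega
      have := h x y z hxy hxz hyz
      omega
    refine (sum_le_sum fun x _ => sum_le_sum fun y _ => sum_le_sum fun z _ => hpt x y z).trans ?_
    simp only [sum_add_distrib, sum_ite_eq, sum_const, smul_eq_mul, card_univ, ← hn, mem_univ,
      if_true, mul_ite, mul_zero]
    apply le_of_eq
    ring
  have hmean := pow_sum_div_card_le_sum_pow (s := (univ : Finset V))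
    (f := fun v => (H.degree v : ℝ)) (fun v _ => by positivity) 2
  rw [← Nat.cast_sum, H.sum_degrees_eq_twice_card_edges, card_univ, ← hn] at hmean
  have hcube' : ∑ v, (H.degree v : ℝ) ^ 3 ≤ (k + 3) * (n : ℝ) ^ 3 := by exact_mod_cast hcube
  rcases Nat.eq_zero_or_pos n with h0 | hpos
  · have : H.edgeFinset = ∅ := by
      have : IsEmpty V := Fintype.card_eq_zero_iff.mp (hn ▸ h0)
      ext e
      induction e with
      | _ a b => exact isEmptyElim a
    simp [this]
  · have hpos' : (0 : ℝ) < (n : ℝ) ^ 2 := by positivity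
    have h1 := (div_le_iff₀ hpos').1 (hmean.trans hcube')
    have : (((2 * #H.edgeFinset) ^ 3 : ℕ) : ℝ) ≤ (((k + 3) * n ^ 5 : ℕ) : ℝ) := by
      push_cast at h1 ⊢
      calc _ ≤ _ := h1
        _ = _ := by ring
    exact_mod_cast this

/-! ### Counting consecutive pairs in a sweep -/

/-- `u` and `v` are consecutive at some position of the sweep, where the life span of `v` is the
open interval from `l v` to `r v`: `u` precedes `v`, and at some common parameter `x` of their life
spans no element alive at `x` lies strictly between them. -/
def IsConsecutive {V : Type*} (l r : V → ℝ) (lt : V → V → Prop) (u v : V) : Prop :=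
  lt u v ∧ ∃ x, (l u < x ∧ x < r u) ∧ (l v < x ∧ x < r v) ∧
    ∀ w, l w < x → x < r w → ¬ (lt u w ∧ lt w v)

/-- As the parameter grows, a new consecutive pair arises only when an element is born, next to one
of its two neighbours, or when an element dies and its two neighbours meet; hence there are at most
three such pairs per element. Elements are compared only within the classes of `cl`, and
simultaneous births and deaths are allowed. -/
theorem ncard_isConsecutive_le {V ι : Type*} [Fintype V] (l r : V → ℝ) (lt : V → V → Prop)
    (cl : V → ι) (hlr : ∀ v, l v < r v)
    (hcl : ∀ u v, lt u v → cl u = cl v)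
    (htot : ∀ u v x, cl u = cl v → u ≠ v → l u < x → x < r u → l v < x → x < r v →
      lt u v ∨ lt v u)
    (htrans : ∀ u w v x, l u < x → x < r u → l w < x → x < r w → l v < x → x < r v →
      lt u w → lt w v → lt u v) :
    {e : V × V | IsConsecutive l r lt e.1 e.2}.ncard ≤ 3 * Fintype.card V := by
  classical
  -- The event `k` at `w` which the pair `u`, `v` is charged to: the birth of the lower element, the
  -- birth of the upper one, or the death of an element between them. The last clause of each
  -- makes the pair unique.
  let R : Fin 3 → V → V → V → Prop := fun k w u v =>
    ![w = u ∧ lt u v ∧ l v ≤ l u ∧ l u < r v ∧ ∀ z, lt u z → l z ≤ l u → l u < r z → ¬ lt z v,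
      w = v ∧ lt u v ∧ l u ≤ l v ∧ l v < r u ∧ ∀ z, lt z v → l z ≤ l v → l v < r z → ¬ lt u z,
      lt u w ∧ lt w v ∧ l u < r w ∧ r w < r u ∧ l v < r w ∧ r w < r v ∧
        ∀ z, l z < r w → r w < r z → ¬ (lt u z ∧ lt z v)] k
  have hex : ∀ e : V × V, IsConsecutive l r lt e.1 e.2 → ∃ c : V × Fin 3, R c.2 c.1 e.1 e.2 := by
    rintro ⟨u, v⟩ ⟨huv, x, ⟨hlu, hru⟩, ⟨hlv, hrv⟩, hx⟩
    dsimp only at *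
    -- elements that separate `u` from `v` and die before `x`; the last of them to die is charged
    let D : Finset V := Finset.univ.filter fun w =>
      (l u < r w ∧ l v < r w ∧ r w ≤ x) ∧ lt u w ∧ lt w v
    by_cases hD : D.Nonempty
    · obtain ⟨w, hwD, hmax⟩ := D.exists_max_image r hD
      obtain ⟨⟨h1, h2, h3⟩, h4, h5⟩ := (Finset.mem_filter.1 hwD).2
      refine ⟨(w, 2), h4, h5, h1, h3.trans_lt hru, h2, h3.trans_lt hrv, ?_⟩
      rintro z hz1 hz2 ⟨hz3, hz4⟩
      rcases le_or_gt (r z) x with hzx | hzx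
      · have := hmax z (Finset.mem_filter.2
          ⟨Finset.mem_univ _, ⟨h1.trans hz2, h2.trans hz2, hzx⟩, hz3, hz4⟩)
        linarith
      · exact hx z (hz1.trans_le h3) hzx ⟨hz3, hz4⟩
    · have hnot : ∀ z, l u < r z → l v < r z → l z < x → lt u z → ¬ lt z v := by
        intro z h1 h2 h3 h4 h5
        rcases le_or_gt (r z) x with hzx | hzx
        · exact hD ⟨z, Finset.mem_filter.2 ⟨Finset.mem_univ _, ⟨h1, h2, hzx⟩, h4, h5⟩⟩
        · exact hx z h3 hzx ⟨h4, h5⟩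
      rcases le_total (l v) (l u) with hle | hle
      · exact ⟨(u, 0), rfl, huv, hle, by linarith, fun z h1 h2 h3 h4 =>
          hnot z h3 (by linarith) (by linarith) h1 h4⟩
      · exact ⟨(v, 1), rfl, huv, hle, by linarith, fun z h1 h2 h3 h4 =>
          hnot z (by linarith) h3 (by linarith) h4 h1⟩
  have huniq : ∀ k w u v u' v', R k w u v → R k w u' v' → u = u' ∧ v = v' := by
    intro k w u v u' v' h h'
    fin_cases k
    · obtain ⟨rfl, h1, h2, h3, h4⟩ := h
      obtain ⟨rfl, h1', h2', h3', h4'⟩ := h'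
      refine ⟨rfl, ?_⟩
      by_contra hne
      obtain ⟨x, hx1, hx2⟩ := exists_between (lt_min h3 h3')
      obtain ⟨hx2, hx3⟩ := lt_min_iff.1 hx2
      rcases htot v v' x ((hcl _ _ h1).symm.trans (hcl _ _ h1')) hne (by linarith) hx2
        (by linarith) hx3 with hlt | hlt
      · exact h4' v h1 h2 h3 hlt
      · exact h4 v' h1' h2' h3' hlt
    · obtain ⟨rfl, h1, h2, h3, h4⟩ := h
      obtain ⟨rfl, h1', h2', h3', h4'⟩ := h'
      refine ⟨?_, rfl⟩
      by_contra hne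
      obtain ⟨x, hx1, hx2⟩ := exists_between (lt_min h3 h3')
      obtain ⟨hx2, hx3⟩ := lt_min_iff.1 hx2
      rcases htot u u' x ((hcl _ _ h1).trans (hcl _ _ h1').symm) hne (by linarith) hx2
        (by linarith) hx3 with hlt | hlt
      · exact h4 u' h1' h2' h3' hlt
      · exact h4' u h1 h2 h3 hlt
    · obtain ⟨h1, h2, h3, h4, h5, h6, h7⟩ := h
      obtain ⟨h1', h2', h3', h4', h5', h6', h7'⟩ := h'
      obtain ⟨x, hx, hxw⟩ := exists_between
        (max_lt (hlr w) (max_lt (max_lt h3 h5) (max_lt h3' h5')))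
      simp only [max_lt_iff] at hx
      obtain ⟨hlw, ⟨hlu, hlv⟩, hlu', hlv'⟩ := hx
      constructor
      · by_contra hne
        rcases htot u u' x ((hcl _ _ h1).trans (hcl _ _ h1').symm) hne hlu (by linarith)
          hlu' (by linarith) with hlt | hlt
        · exact h7 u' h3' h4' ⟨hlt, htrans u' w v x hlu' (by linarith) hlw hxw hlv (by linarith)
            h1' h2⟩
        · exact h7' u h3 h4 ⟨hlt, htrans u w v' x hlu (by linarith) hlw hxw hlv' (by linarith)
            h1 h2'⟩
      · by_contra hne
        rcases htot v v' x ((hcl _ _ h2).symm.trans (hcl _ _ h2')) hne hlv (by linarith)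
          hlv' (by linarith) with hlt | hlt
        · exact h7' v h5 h6 ⟨htrans u' w v x hlu' (by linarith) hlw hxw hlv (by linarith)
            h1' h2, hlt⟩
        · exact h7 v' h5' h6' ⟨htrans u w v' x hlu (by linarith) hlw hxw hlv' (by linarith)
            h1 h2', hlt⟩
  choose f hf using fun e : {e : V × V | IsConsecutive l r lt e.1 e.2} => hex e.1 e.2
  have hinj : Function.Injective f := by
    rintro ⟨⟨u, v⟩, he⟩ ⟨⟨u', v'⟩, he'⟩ hee
    have h1 := hf ⟨(u, v), he⟩
    have h2 := hf ⟨(u', v'), he'⟩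
    rw [← hee] at h2
    obtain ⟨rfl, rfl⟩ := huniq _ _ _ _ _ _ h1 h2
    rfl
  calc _ ≤ Nat.card (V × Fin 3) := Nat.card_le_card_of_injective f hinj
    _ = 3 * Fintype.card V := by
      rw [Nat.card_eq_fintype_card, Fintype.card_prod, Fintype.card_fin, mul_comm]

/-! ### Affine functionals: three bodies and three plates -/

theorem coeff_eq_zero_of_sameSign {b c p p' q q' P Q s t : ℝ} (hp : 0 < p) (hp' : 0 < p')
    (hq : 0 < q) (hq' : 0 < q') (hP : 0 < P) (hQ : 0 < Q) (hS : b * p + c * p' = s * P)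
    (hT : b * q + c * q' = t * Q) (hst : s * t ≤ 0)
    (hbc : (0 ≤ b ∧ 0 ≤ c) ∨ (b ≤ 0 ∧ c ≤ 0)) : s = 0 ∧ t = 0 ∧ b = 0 ∧ c = 0 := by
  wlog h : 0 ≤ b ∧ 0 ≤ c generalizing b c s t
  · have h' := hbc.resolve_left h
    have := this (b := -b) (c := -c) (s := -s) (t := -t) (by linarith) (by linarith)
      (by linarith) (Or.inl ⟨by linarith, by linarith⟩) ⟨by linarith, by linarith⟩
    simpa using this
  obtain ⟨hb, hc⟩ := h
  have h1 : 0 ≤ s * P := by rw [← hS]; positivity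
  have h2 : 0 ≤ t * Q := by rw [← hT]; positivity
  have hs : 0 ≤ s := nonneg_of_mul_nonneg_left h1 hP
  have ht : 0 ≤ t := nonneg_of_mul_nonneg_left h2 hQ
  have hor : s = 0 ∨ t = 0 := mul_eq_zero.1 (le_antisymm hst (mul_nonneg hs ht))
  have key : ∀ {p p' : ℝ}, 0 < p → 0 < p' → b * p + c * p' = 0 → b = 0 ∧ c = 0 := by
    intro p p' hp hp' h
    have hbp : 0 ≤ b * p := by positivity
    have hcp : 0 ≤ c * p' := by positivity
    constructor
    · exact (mul_eq_zero.1 (by linarith : b * p = 0)).resolve_right hp.ne'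
    · exact (mul_eq_zero.1 (by linarith : c * p' = 0)).resolve_right hp'.ne'
  have h0 : b = 0 ∧ c = 0 := by
    rcases hor with rfl | rfl
    · exact key hp hp' (by linarith)
    · exact key hq hq' (by linarith)
  obtain ⟨rfl, rfl⟩ := h0
  refine ⟨?_, ?_, rfl, rfl⟩
  · exact (mul_eq_zero.1 (by linarith : s * P = 0)).resolve_right hP.ne'
  · exact (mul_eq_zero.1 (by linarith : t * Q = 0)).resolve_right hQ.ne'

/-- Let `m i` and `m' i` be the points at which two bodies, with plane functionals `f` and `f'`, touch
plate `i`, with plane functional `g i`. Suppose that the contact points of the two bodies lie on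
the positive side of each other's planes, and that each `g j` has the sign of `σ` on the `m i` and of
`σ'` on the `m' i`, `i ≠ j`. A relation `x • f + y • f' = ∑ i, ν i • g i` evaluated at `m i` and `m' i`
gives the signs of two combinations of the two coefficients `ν j`, `j ≠ i`. As two of three
reals always have the same weak sign, `σ * σ' * (x * y)` must be positive unless the relation is
trivial. -/
theorem coeff_eq_zero_of_relation {E : Type*} [AddCommGroup E] [Module ℝ E]
    {f f' : E →ᵃ[ℝ] ℝ} {g : Fin 3 → E →ᵃ[ℝ] ℝ} {m m' : Fin 3 → E} {σ σ' x y : ℝ} {ν : Fin 3 → ℝ}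
    (hfm : ∀ i, f (m i) = 0) (hfm' : ∀ i, 0 < f (m' i))
    (hf'm : ∀ i, 0 < f' (m i)) (hf'm' : ∀ i, f' (m' i) = 0)
    (hgm : ∀ i, g i (m i) = 0) (hgm' : ∀ i, g i (m' i) = 0)
    (hg : ∀ i j, i ≠ j → 0 < σ * g i (m j)) (hg' : ∀ i j, i ≠ j → 0 < σ' * g i (m' j))
    (hrel : x • f + y • f' = ∑ i, ν i • g i) (hxy : σ * σ' * (x * y) ≤ 0) :
    x = 0 ∧ y = 0 ∧ ν = 0 := by
  have hev : ∀ p, x * f p + y * f' p = ν 0 * g 0 p + ν 1 * g 1 p + ν 2 * g 2 p := by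
    intro p
    have := congrArg (fun h : E →ᵃ[ℝ] ℝ => h p) hrel
    simpa [Fin.sum_univ_three] using this
  have hσ : σ ≠ 0 := left_ne_zero_of_mul (hg 0 1 (by decide)).ne'
  have hσ' : σ' ≠ 0 := left_ne_zero_of_mul (hg' 0 1 (by decide)).ne'
  have hst : (σ * y) * (σ' * x) ≤ 0 := by linarith [hxy, mul_comm x y]
  have hx0 : σ' * x = 0 → x = 0 := fun h => (mul_eq_zero.1 h).resolve_left hσ'
  have hy0 : σ * y = 0 → y = 0 := fun h => (mul_eq_zero.1 h).resolve_left hσ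
  have hS : ∀ i, ν 0 * (σ * g 0 (m i)) + ν 1 * (σ * g 1 (m i)) + ν 2 * (σ * g 2 (m i))
      = (σ * y) * f' (m i) := by
    intro i
    have := hev (m i)
    rw [hfm i] at this
    linear_combination (-σ) * this
  have hT : ∀ i, ν 0 * (σ' * g 0 (m' i)) + ν 1 * (σ' * g 1 (m' i)) + ν 2 * (σ' * g 2 (m' i))
      = (σ' * x) * f (m' i) := by
    intro i
    have := hev (m' i)
    rw [hf'm' i] at this
    linear_combination (-σ') * this
  have hS0 := hS 0
  have hS1 := hS 1
  have hS2 := hS 2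
  have hT0 := hT 0
  have hT1 := hT 1
  have hT2 := hT 2
  rw [hgm 0] at hS0
  rw [hgm 1] at hS1
  rw [hgm 2] at hS2
  rw [hgm' 0] at hT0
  rw [hgm' 1] at hT1
  rw [hgm' 2] at hT2
  simp only [mul_zero, zero_add, add_zero] at hS0 hS1 hS2 hT0 hT1 hT2
  have c12 := coeff_eq_zero_of_sameSign (hg 1 0 (by decide)) (hg 2 0 (by decide))
    (hg' 1 0 (by decide)) (hg' 2 0 (by decide)) (hf'm 0) (hfm' 0) hS0 hT0 hst
  have c02 := coeff_eq_zero_of_sameSign (hg 0 1 (by decide)) (hg 2 1 (by decide))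
    (hg' 0 1 (by decide)) (hg' 2 1 (by decide)) (hf'm 1) (hfm' 1) hS1 hT1 hst
  have c01 := coeff_eq_zero_of_sameSign (hg 0 2 (by decide)) (hg 1 2 (by decide))
    (hg' 0 2 (by decide)) (hg' 1 2 (by decide)) (hf'm 2) (hfm' 2) hS2 hT2 hst
  have hfin : (ν 1 = 0 ∧ ν 2 = 0) ∨ (ν 0 = 0 ∧ ν 2 = 0) ∨ (ν 0 = 0 ∧ ν 1 = 0) →
      x = 0 ∧ y = 0 ∧ ν 0 = 0 ∧ ν 1 = 0 ∧ ν 2 = 0 := by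
    rintro (⟨ha, hb⟩ | ⟨ha, hb⟩ | ⟨ha, hb⟩)
    · obtain ⟨p, q, -, -⟩ := c12 (by simp [ha, hb])
      obtain ⟨-, -, h0, -⟩ := c02 (by rcases le_total 0 (ν 0) with h | h <;> simp [h, hb])
      exact ⟨hx0 q, hy0 p, h0, ha, hb⟩
    · obtain ⟨p, q, -, -⟩ := c02 (by simp [ha, hb])
      obtain ⟨-, -, h0, -⟩ := c12 (by rcases le_total 0 (ν 1) with h | h <;> simp [h, hb])
      exact ⟨hx0 q, hy0 p, ha, h0, hb⟩
    · obtain ⟨p, q, -, -⟩ := c01 (by simp [ha, hb])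
      obtain ⟨-, -, -, h0⟩ := c12 (by rcases le_total 0 (ν 2) with h | h <;> simp [h, hb])
      exact ⟨hx0 q, hy0 p, ha, hb, h0⟩
  have hall : x = 0 ∧ y = 0 ∧ ν 0 = 0 ∧ ν 1 = 0 ∧ ν 2 = 0 := by
    apply hfin
    rcases le_total 0 (ν 0) with h0 | h0 <;> rcases le_total 0 (ν 1) with h1 | h1 <;>
      rcases le_total 0 (ν 2) with h2 | h2
    · exact Or.inl (c12 (Or.inl ⟨h1, h2⟩)).2.2
    · exact Or.inr (Or.inr (c01 (Or.inl ⟨h0, h1⟩)).2.2)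
    · exact Or.inr (Or.inl (c02 (Or.inl ⟨h0, h2⟩)).2.2)
    · exact Or.inl (c12 (Or.inr ⟨h1, h2⟩)).2.2
    · exact Or.inl (c12 (Or.inl ⟨h1, h2⟩)).2.2
    · exact Or.inr (Or.inl (c02 (Or.inr ⟨h0, h2⟩)).2.2)
    · exact Or.inr (Or.inr (c01 (Or.inr ⟨h0, h1⟩)).2.2)
    · exact Or.inl (c12 (Or.inr ⟨h1, h2⟩)).2.2
  refine ⟨hall.1, hall.2.1, funext fun i => ?_⟩
  fin_cases i
  · exact hall.2.2.1
  · exact hall.2.2.2.1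
  · exact hall.2.2.2.2

theorem finrank_affineMap_real : Module.finrank ℝ (E3 →ᵃ[ℝ] ℝ) = 4 := by
  have e : (E3 →ᵃ[ℝ] ℝ) ≃ₗ[ℝ] ℝ × (E3 →ₗ[ℝ] ℝ) := AffineMap.toConstProdLinearMap ℝ
  rw [LinearEquiv.finrank_eq e]
  simp

/-- Five affine functionals on 3-space are linearly dependent. -/
theorem exists_relation (f f' : E3 →ᵃ[ℝ] ℝ) (g : Fin 3 → E3 →ᵃ[ℝ] ℝ) :
    ∃ (x y : ℝ) (ν : Fin 3 → ℝ), x • f + y • f' = ∑ i, ν i • g i ∧ ¬ (x = 0 ∧ y = 0 ∧ ν = 0) := by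
  let T : (ℝ × ℝ × (Fin 3 → ℝ)) →ₗ[ℝ] (E3 →ᵃ[ℝ] ℝ) :=
    (LinearMap.toSpanSingleton ℝ _ f).coprod ((LinearMap.toSpanSingleton ℝ _ f').coprod
      (-(Fintype.linearCombination ℝ g)))
  have hker : T.ker ≠ ⊥ := by
    apply LinearMap.ker_ne_bot_of_finrank_lt
    rw [finrank_affineMap_real]
    simp
  obtain ⟨⟨x, y, ν⟩, hmem, hne⟩ := T.ker.exists_mem_ne_zero_of_ne_bot hker
  refine ⟨x, y, ν, ?_, fun ⟨hx, hy, hν⟩ => hne (by simp [hx, hy, hν])⟩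
  have : x • f + (y • f' + -∑ i, ν i • g i) = 0 := by
    simpa [T, Fintype.linearCombination_apply] using hmem
  rw [← add_assoc, ← sub_eq_add_neg, sub_eq_zero] at this
  exact this

/-- Three bodies cannot touch three plates if the mutual positions have uniform signs. Here `f X` is
the plane functional of body `X`, `g i` that of plate `i`, and `m X i` a point of contact. Modulo
the span of the `g i` the three `f X` are proportional to each other, and the ratio of `f X` and
`f Y` has the sign of `-(σ X * σ Y)`; these three signs do not multiply consistently. -/
theorem false_of_three_plates {f g : Fin 3 → E3 →ᵃ[ℝ] ℝ} {m : Fin 3 → Fin 3 → E3} {σ : Fin 3 → ℝ}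
    (hfm : ∀ X i, f X (m X i) = 0) (hf : ∀ X Y i, X ≠ Y → 0 < f X (m Y i))
    (hgm : ∀ X i, g i (m X i) = 0) (hg : ∀ X i j, i ≠ j → 0 < σ X * g i (m X j)) : False := by
  have hpair : ∀ X Y, X ≠ Y → ∃ (x y : ℝ) (ν : Fin 3 → ℝ),
      x • f X + y • f Y = ∑ i, ν i • g i ∧ 0 < σ X * σ Y * (x * y) := by
    intro X Y hXY
    obtain ⟨x, y, ν, hrel, hne⟩ := exists_relation (f X) (f Y) g
    refine ⟨x, y, ν, hrel, ?_⟩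
    by_contra hneg
    exact hne (coeff_eq_zero_of_relation (hfm X) (fun i => hf X Y i hXY)
      (fun i => hf Y X i hXY.symm) (hfm Y) (hgm X) (hgm Y) (hg X) (hg Y) hrel (not_lt.1 hneg))
  obtain ⟨x, y, ν, hrel, hpos⟩ := hpair 0 1 (by decide)
  obtain ⟨x', y', ν', hrel', hpos'⟩ := hpair 1 2 (by decide)
  -- eliminating `f 1` from the relations of the pairs `0, 1` and `1, 2`
  have hrel'' : (x * x') • f 0 + (-(y * y')) • f 2 = ∑ i, (x' * ν i - y * ν' i) • g i := by
    have : ∑ i, (x' * ν i - y * ν' i) • g i = x' • ∑ i, ν i • g i - y • ∑ i, ν' i • g i := by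
      simp only [sub_smul, mul_smul, Finset.sum_sub_distrib, Finset.smul_sum]
    rw [this, ← hrel, ← hrel']
    module
  have hneg : σ 0 * σ 2 * ((x * x') * (-(y * y'))) ≤ 0 := by
    have hprod := mul_pos hpos hpos'
    have hσ : 0 < σ 1 ^ 2 := by
      have : σ 1 ≠ 0 := left_ne_zero_of_mul (hg 1 0 1 (by decide)).ne'
      positivity
    have : 0 < σ 0 * σ 2 * ((x * x') * (y * y')) := by
      refine pos_of_mul_pos_right (a := σ 1 ^ 2) ?_ hσ.le
      calc _ < _ := hprod
        _ = _ := by ring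
    linarith
  have h0 := (coeff_eq_zero_of_relation (hfm 0) (fun i => hf 0 2 i (by decide))
      (fun i => hf 2 0 i (by decide)) (hfm 2) (hgm 0) (hgm 2) (hg 0) (hg 2) hrel'' hneg).1
  rcases mul_eq_zero.1 h0 with rfl | rfl
  · simp at hpos
  · simp at hpos'

/-! ### Sides of polygons -/

/-- An affine functional that vanishes on a side of a polygon, but not on the whole polygon, has
constant sign on the rest: in the plane of the polygon it is proportional to the functional that
exposes the side. -/
theorem pos_or_neg_off_side {P s : Set E3} (hP : Module.finrank ℝ (vectorSpan ℝ P) = 2)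
    (hs : IsSide s P) {f : E3 →ᵃ[ℝ] ℝ} (hf : ∀ p ∈ s, f p = 0) (hne : ∃ p ∈ P, f p ≠ 0) :
    (∀ p ∈ P, p ∉ s → 0 < f p) ∨ (∀ p ∈ P, p ∉ s → f p < 0) := by
  obtain ⟨⟨a, b, hab, rfl⟩, hexp⟩ := hs
  obtain ⟨l, hl⟩ := hexp ⟨a, left_mem_segment ℝ a b⟩
  have ha : a ∈ P ∧ ∀ y ∈ P, l y ≤ l a := by
    have : a ∈ segment ℝ a b := left_mem_segment ℝ a b
    rwa [hl] at this
  have hb : b ∈ P ∧ ∀ y ∈ P, l y ≤ l b := by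
    have : b ∈ segment ℝ a b := right_mem_segment ℝ a b
    rwa [hl] at this
  have hlab : l b = l a := le_antisymm (ha.2 b hb.1) (hb.2 a ha.1)
  have hlt : ∀ p ∈ P, p ∉ segment ℝ a b → l p < l a := by
    intro p hp hps
    by_contra hle
    apply hps
    rw [hl]
    exact ⟨hp, fun y hy => (ha.2 y hy).trans (not_lt.1 hle)⟩
  obtain ⟨q, hq, hfq⟩ := hne
  have hlq : l q < l a := hlt q hq fun h => hfq (hf q h)
  have hfa : f a = 0 := hf a (left_mem_segment ℝ a b)
  have hfb : f b = 0 := hf b (right_mem_segment ℝ a b)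
  have hf' : ∀ p, f p = f.linear (p - a) := by
    intro p
    have := f.linearMap_vsub p a
    simp only [vsub_eq_sub, hfa, sub_zero] at this
    exact this.symm
  have hli : LinearIndependent ℝ ![b - a, q - a] := by
    rw [LinearIndependent.pair_iff]
    intro x y hxy
    have h1 := congrArg l hxy
    simp only [map_add, map_smul, map_sub, hlab, smul_eq_mul, map_zero, sub_self, mul_zero,
      zero_add] at h1
    have hy : y = 0 := (mul_eq_zero.1 h1).resolve_right (sub_neg.2 hlq).ne
    rw [hy, zero_smul, add_zero] at hxy
    exact ⟨(smul_eq_zero.1 hxy).resolve_right (sub_ne_zero.2 hab.symm), hy⟩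
  have hspan : Submodule.span ℝ (Set.range ![b - a, q - a]) = vectorSpan ℝ P := by
    apply Submodule.eq_of_le_of_finrank_eq
    · rw [Submodule.span_le]
      rintro _ ⟨i, rfl⟩
      fin_cases i
      · exact vsub_mem_vectorSpan ℝ hb.1 ha.1
      · exact vsub_mem_vectorSpan ℝ hq ha.1
    · rw [finrank_span_eq_card hli, hP, Fintype.card_fin]
  have hdecomp : ∀ p ∈ P, ∃ y : ℝ, l p - l a = y * (l q - l a) ∧ f p = y * f q := by
    intro p hp
    have hmem : p - a ∈ vectorSpan ℝ P := vsub_mem_vectorSpan ℝ hp ha.1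
    rw [← hspan] at hmem
    simp only [Matrix.range_cons, Matrix.range_empty, Set.union_empty,
      Set.singleton_union] at hmem
    obtain ⟨x, y, hxy⟩ := Submodule.mem_span_pair.1 hmem
    refine ⟨y, ?_, ?_⟩
    · rw [← map_sub l p a, ← hxy]
      simp [hlab]
    · rw [hf' p, ← hxy, map_add, map_smul, map_smul, ← hf' b, ← hf' q, hfb]
      simp
  have hpos : ∀ p ∈ P, p ∉ segment ℝ a b → ∃ y : ℝ, 0 < y ∧ f p = y * f q := by
    intro p hp hps
    obtain ⟨y, h1, h2⟩ := hdecomp p hp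
    refine ⟨y, ?_, h2⟩
    have := hlt p hp hps
    by_contra hy
    nlinarith [mul_nonneg_of_nonpos_of_nonpos (not_lt.1 hy) (sub_neg.2 hlq).le]
  rcases lt_or_gt_of_ne hfq with hq | hq
  · right
    intro p hp hps
    obtain ⟨y, hy, h⟩ := hpos p hp hps
    rw [h]
    exact mul_neg_of_pos_of_neg hy hq
  · left
    intro p hp hps
    obtain ⟨y, hy, h⟩ := hpos p hp hps
    rw [h]
    exact mul_pos hy hq

theorem pos_sign_mul {P s : Set E3} {f : E3 → ℝ} {c : Bool}
    [Decidable (∀ p ∈ P, p ∉ s → 0 < f p)] (hc : decide (∀ p ∈ P, p ∉ s → 0 < f p) = c)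
    (h : (∀ p ∈ P, p ∉ s → 0 < f p) ∨ (∀ p ∈ P, p ∉ s → f p < 0)) :
    ∀ p ∈ P, p ∉ s → 0 < (if c then (1 : ℝ) else -1) * f p := by
  intro p hp hps
  cases c with
  | true => simpa using of_decide_eq_true hc p hp hps
  | false => simpa using h.resolve_left (of_decide_eq_false hc) p hp hps

/-- Every side contains a point, its midpoint, that lies on no other side of any polygon having
this side. -/
theorem exists_mem_side_only {s Q : Set E3} (hs : IsSide s Q) :
    ∃ m ∈ s, ∀ P t, IsSide s P → IsSide t P → t ≠ s → m ∉ t := by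
  obtain ⟨⟨a, b, hab, rfl⟩, -⟩ := hs
  refine ⟨midpoint ℝ a b, midpoint_mem_segment a b, ?_⟩
  rintro P t ⟨-, hs⟩ ⟨⟨c, d, hcd, rfl⟩, ht⟩ hne hm
  apply hne
  have haP : a ∈ P := hs.subset (left_mem_segment ℝ a b)
  have hbP : b ∈ P := hs.subset (right_mem_segment ℝ a b)
  have hcP : c ∈ P := ht.subset (left_mem_segment ℝ c d)
  have hdP : d ∈ P := ht.subset (right_mem_segment ℝ c d)
  obtain ⟨l, hl⟩ := hs ⟨a, left_mem_segment ℝ a b⟩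
  obtain ⟨k, hk⟩ := ht ⟨c, left_mem_segment ℝ c d⟩
  have hmk := hm
  rw [hk] at hmk
  have hkm : k (midpoint ℝ a b) = (k a + k b) / 2 := by
    rw [midpoint_eq_smul_add, map_smul, map_add, smul_eq_mul, invOf_eq_inv]
    ring
  have hka := hmk.2 a haP
  have hkb := hmk.2 b hbP
  have hat : a ∈ segment ℝ c d := by
    rw [hk]
    exact ⟨haP, fun y hy => (hmk.2 y hy).trans (by linarith)⟩
  have hbt : b ∈ segment ℝ c d := by
    rw [hk]
    exact ⟨hbP, fun y hy => (hmk.2 y hy).trans (by linarith)⟩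
  have hla : a ∈ P ∧ ∀ y ∈ P, l y ≤ l a := by
    have : a ∈ segment ℝ a b := left_mem_segment ℝ a b
    rwa [hl] at this
  have hlb : b ∈ P ∧ ∀ y ∈ P, l y ≤ l b := by
    have : b ∈ segment ℝ a b := right_mem_segment ℝ a b
    rwa [hl] at this
  refine Set.Subset.antisymm ?_ ((convex_segment c d).segment_subset hat hbt)
  obtain ⟨x, y, hx, hy, hxy, hxa⟩ := hat
  obtain ⟨x', y', hx', hy', hxy', hxb⟩ := hbt
  have h1 : x * l c + y * l d = l a := by rw [← hxa]; simp
  have h2 : x' * l c + y' * l d = l a := by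
    rw [le_antisymm (hlb.2 a haP) (hla.2 b hbP), ← hxb]
    simp
  have hlc := hla.2 c hcP
  have hld := hla.2 d hdP
  have key : ∀ {x y u v : ℝ}, 0 ≤ x → 0 ≤ y → x + y = 1 → x * u + y * v = l a → u ≤ l a →
      v ≤ l a → ¬ l a ≤ u → x = 0 := by
    intro x y u v hx hy hxy heq hu hv hlt
    have h1 : x * (l a - u) + y * (l a - v) = 0 := by linear_combination l a * hxy - heq
    have h2 := mul_nonneg hy (sub_nonneg.2 hv)
    have h3 := mul_nonneg hx (sub_nonneg.2 hu)
    exact (mul_eq_zero.1 (by linarith : x * (l a - u) = 0)).resolve_right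
      (sub_pos.2 (not_le.1 hlt)).ne'
  have hlc' : l a ≤ l c := by
    by_contra hlt
    have hx0 := key hx hy hxy h1 hlc hld hlt
    have hx0' := key hx' hy' hxy' h2 hlc hld hlt
    apply hab
    rw [← hxa, ← hxb, hx0, hx0', show y = 1 by linarith, show y' = 1 by linarith]
  have hld' : l a ≤ l d := by
    by_contra hlt
    have hy0 := key hy hx (by linarith) (by linarith) hld hlc hlt
    have hy0' := key hy' hx' (by linarith) (by linarith) hld hlc hlt
    apply hab
    rw [← hxa, ← hxb, hy0, hy0', show x = 1 by linarith, show x' = 1 by linarith]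
  have hconv : Convex ℝ (segment ℝ a b) := convex_segment a b
  refine hconv.segment_subset ?_ ?_
  · rw [hl]
    exact ⟨hcP, fun z hz => (hla.2 z hz).trans hlc'⟩
  · rw [hl]
    exact ⟨hdP, fun z hz => (hla.2 z hz).trans hld'⟩

theorem IsConvexPolygon.nonempty {P : Set E3} (hP : IsConvexPolygon P) : P.Nonempty := by
  rw [Set.nonempty_iff_ne_empty]
  rintro rfl
  have := hP.2
  rw [vectorSpan_empty, finrank_bot] at this
  norm_num at this

/-- The plane of a polygon is the zero set of an affine functional. -/
theorem IsConvexPolygon.exists_eq_zero_iff {P : Set E3} (hP : IsConvexPolygon P) :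
    ∃ f : E3 →ᵃ[ℝ] ℝ, ∀ p, f p = 0 ↔ p ∈ affineSpan ℝ P := by
  obtain ⟨q, hq⟩ := hP.nonempty
  have hlt : vectorSpan ℝ P < ⊤ := by
    rw [lt_top_iff_ne_top]
    intro h
    have := hP.2
    rw [h, finrank_top] at this
    simp at this
  obtain ⟨φ, hφ, hle⟩ := Submodule.exists_le_ker_of_lt_top _ hlt
  have hker : vectorSpan ℝ P = LinearMap.ker φ := by
    apply Submodule.eq_of_le_of_finrank_eq hle
    have h1 := Module.Dual.finrank_ker_add_one_of_ne_zero hφ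
    have h2 : Module.finrank ℝ E3 = 3 := by simp
    rw [hP.2]
    omega
  refine ⟨φ.toAffineMap - AffineMap.const ℝ E3 (φ q), fun p => ?_⟩
  rw [← AffineSubspace.vsub_right_mem_direction_iff_mem (mem_affineSpan ℝ hq), direction_affineSpan,
    hker]
  simp

theorem IsConvexPolygon.affineSpan_eq_of_subset {P Q : Set E3} (hP : IsConvexPolygon P)
    (hQ : IsConvexPolygon Q) (h : P ⊆ affineSpan ℝ Q) : affineSpan ℝ P = affineSpan ℝ Q := by
  have hle : affineSpan ℝ P ≤ affineSpan ℝ Q := affineSpan_le.2 h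
  refine AffineSubspace.eq_of_direction_eq_of_nonempty_of_le ?_
    (hP.nonempty.mono (subset_affineSpan ℝ P)) hle
  apply Submodule.eq_of_le_of_finrank_eq (AffineSubspace.direction_le hle)
  rw [direction_affineSpan, direction_affineSpan, hP.2, hQ.2]

theorem IsSideContactRep.false_of_three {V : Type*} {G : SimpleGraph V} {P : V → Set E3}
    (h : IsSideContactRep G P) {u v w : V} (huv : u ≠ v) (huw : u ≠ w) (hvw : v ≠ w) {s : Set E3}
    (hu : IsSide s (P u)) (hv : IsSide s (P v)) (hw : IsSide s (P w)) : False := by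
  have hsub : ({u, v, w} : Set V) ⊆ {x | IsSide s (P x)} := by
    rintro x (rfl | rfl | rfl) <;> assumption
  have := (Set.encard_le_encard hsub).trans (h.side_le_two s)
  rw [Set.encard_insert_of_notMem (by simp [huv, huw]), Set.encard_pair hvw] at this
  norm_num at this

/-! ### Contacts between different planes -/

/-- The graph of those contacts whose two polygons lie in different planes. -/
def crossPlaneGraph {V : Type*} (G : SimpleGraph V) (P : V → Set E3) : SimpleGraph V where
  Adj u v := G.Adj u v ∧ affineSpan ℝ (P u) ≠ affineSpan ℝ (P v)
  symm := ⟨fun _ _ h => ⟨h.1.symm, h.2.symm⟩⟩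
  loopless := ⟨fun _ h => h.2 rfl⟩

open Finset in
/-- Among `129` common neighbours (plates) of three polygons (bodies) there would be three that have the
same position relative to them, where a position consists of six signs: for each body, the side of
the plate on which the body lies and the side of the body on which the plate lies. This
contradicts `false_of_three_plates`. -/
theorem IsSideContactRep.card_common_neighbors_le {V : Type*} [Fintype V] [DecidableEq V]
    {G : SimpleGraph V} {P : V → Set E3} (h : IsSideContactRep G P)
    [DecidableRel (crossPlaneGraph G P).Adj] {x y z : V} (hxy : x ≠ y) (hxz : x ≠ z) (hyz : y ≠ z) :
    #{v | (crossPlaneGraph G P).Adj x v ∧ (crossPlaneGraph G P).Adj y v ∧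
      (crossPlaneGraph G P).Adj z v} ≤ 128 := by
  classical
  by_contra hcard
  rw [not_le] at hcard
  set S : Finset V := {v | (crossPlaneGraph G P).Adj x v ∧ (crossPlaneGraph G P).Adj y v ∧
      (crossPlaneGraph G P).Adj z v}
  choose f hf using fun v => (h.convexPolygon v).exists_eq_zero_iff
  have hfP : ∀ v, ∀ p ∈ P v, f v p = 0 := fun v p hp => (hf v p).2 (mem_affineSpan ℝ hp)
  let body : Fin 3 → V := ![x, y, z]
  have hbody : Function.Injective body := by
    intro i j hij
    fin_cases i <;> fin_cases j <;>
      simp [body, hxy, hxz, hyz, hxy.symm, hxz.symm, hyz.symm] at hij ⊢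
  have hadj : ∀ X, ∀ v ∈ S, (crossPlaneGraph G P).Adj (body X) v := by
    intro X v hv
    have := (mem_filter.1 hv).2
    fin_cases X
    · exact this.1
    · exact this.2.1
    · exact this.2.2
  have hside : ∀ X, ∀ v ∈ S, ∃ (s : Set E3) (m : E3), IsSide s (P (body X)) ∧ IsSide s (P v) ∧
      m ∈ s ∧ ∀ Q t, IsSide s Q → IsSide t Q → t ≠ s → m ∉ t := by
    intro X v hv
    have hG := (hadj X v hv).1
    obtain ⟨s, h1, h2⟩ := (h.adj_iff _ _ hG.ne).1 hG
    obtain ⟨m, h3, h4⟩ := exists_mem_side_only h1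
    exact ⟨s, m, h1, h2, h3, h4⟩
  choose! s m hsb hsp hms hm using hside
  have hsign : ∀ {u v t}, G.Adj u v → affineSpan ℝ (P u) ≠ affineSpan ℝ (P v) →
      IsSide t (P u) → IsSide t (P v) →
      (∀ p ∈ P u, p ∉ t → 0 < f v p) ∨ (∀ p ∈ P u, p ∉ t → f v p < 0) := by
    intro u v t hG hne htu htv
    refine pos_or_neg_off_side (h.convexPolygon u).2 htu
      (fun p hp => hfP v p (htv.2.subset hp)) ?_
    by_contra hcon
    push Not at hcon
    exact hne ((h.convexPolygon u).affineSpan_eq_of_subset (h.convexPolygon v)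
      fun p hp => (hf v p).1 (hcon p hp))
  let κ : V → Fin 3 → Bool × Bool := fun v X =>
    (decide (∀ p ∈ P (body X), p ∉ s X v → 0 < f v p),
      decide (∀ p ∈ P v, p ∉ s X v → 0 < f (body X) p))
  obtain ⟨c, -, hc⟩ := Finset.exists_lt_card_fiber_of_mul_lt_card_of_maps_to (s := S)
    (t := (univ : Finset (Fin 3 → Bool × Bool))) (f := κ) (n := 2) (fun _ _ => mem_univ _)
    (by simpa using hcard)
  obtain ⟨p₀, p₁, p₂, hp₀, hp₁, hp₂, h01, h02, h12⟩ := Finset.two_lt_card_iff.1 hc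
  let plate : Fin 3 → V := ![p₀, p₁, p₂]
  have hplate : Function.Injective plate := by
    intro i j hij
    fin_cases i <;> fin_cases j <;>
      simp [plate, h01, h02, h12, h01.symm, h02.symm, h12.symm] at hij ⊢
  have hmem : ∀ i, plate i ∈ S ∧ κ (plate i) = c := by
    intro i
    fin_cases i
    · exact mem_filter.1 hp₀
    · exact mem_filter.1 hp₁
    · exact mem_filter.1 hp₂
  let σ : Fin 3 → ℝ := fun X => if (c X).1 then 1 else -1
  let τ : Fin 3 → ℝ := fun X => if (c X).2 then 1 else -1
  have hσ : ∀ X i, ∀ p ∈ P (body X), p ∉ s X (plate i) → 0 < σ X * f (plate i) p := by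
    intro X i
    obtain ⟨hiS, hic⟩ := hmem i
    have hcX : decide (∀ p ∈ P (body X), p ∉ s X (plate i) → 0 < f (plate i) p) = (c X).1 :=
      congrArg Prod.fst (congrFun hic X)
    exact pos_sign_mul hcX (hsign (hadj X _ hiS).1 (hadj X _ hiS).2 (hsb X _ hiS) (hsp X _ hiS))
  have hτ : ∀ X i, ∀ p ∈ P (plate i), p ∉ s X (plate i) → 0 < τ X * f (body X) p := by
    intro X i
    obtain ⟨hiS, hic⟩ := hmem i
    have hcX : decide (∀ p ∈ P (plate i), p ∉ s X (plate i) → 0 < f (body X) p) = (c X).2 :=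
      congrArg Prod.snd (congrFun hic X)
    exact pos_sign_mul hcX (hsign (hadj X _ hiS).1.symm (hadj X _ hiS).2.symm (hsp X _ hiS)
      (hsb X _ hiS))
  have hne : ∀ X i, body X ≠ plate i := fun X i => (hadj X _ (hmem i).1).1.ne
  refine false_of_three_plates (f := fun X => τ X • f (body X)) (g := fun i => f (plate i))
    (m := fun X i => m X (plate i)) (σ := σ) ?_ ?_ ?_ ?_
  · intro X i
    have hi := (hmem i).1
    simp [hfP (body X) _ ((hsb X _ hi).2.subset (hms X _ hi))]
  · intro X Y i hXY
    have hi := (hmem i).1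
    refine hτ X i _ ((hsp Y _ hi).2.subset (hms Y _ hi))
      (hm Y _ hi _ _ (hsp Y _ hi) (hsp X _ hi) fun heq => ?_)
    exact h.false_of_three (hbody.ne hXY) (hne X i) (hne Y i) (heq ▸ hsb X _ hi) (hsb Y _ hi)
      (hsp Y _ hi)
  · intro X i
    have hi := (hmem i).1
    exact hfP _ _ ((hsp X _ hi).2.subset (hms X _ hi))
  · intro X i j hij
    have hi := (hmem i).1
    have hj := (hmem j).1
    refine hσ X i _ ((hsb X _ hj).2.subset (hms X _ hj))
      (hm X _ hj _ _ (hsb X _ hj) (hsb X _ hi) fun heq => ?_)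
    exact h.false_of_three (hne X i) (hne X j) (hplate.ne hij) (hsb X _ hj)
      (heq ▸ hsp X _ hi) (hsp X _ hj)

/-! ### Touching convex sets in the plane -/

/-- Two disjoint convex sets are in the same vertical order over every point over which both
are present. -/
theorem lt_of_lt_of_disjoint {D D' : Set (ℝ × ℝ)} (hD : Convex ℝ D) (hD' : Convex ℝ D')
    (hdisj : Disjoint D D') {x₁ x₂ y y' z z' : ℝ} (hy : (x₁, y) ∈ D) (hy' : (x₁, y') ∈ D')
    (hlt : y < y') (hz : (x₂, z) ∈ D) (hz' : (x₂, z') ∈ D') : z < z' := by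
  by_contra hle
  rw [not_lt] at hle
  have hs : 0 < (y' - y) + (z - z') := by linarith
  -- the vertical distance vanishes at the parameter `t` between `x₁` and `x₂`
  set t := (y' - y) / ((y' - y) + (z - z'))
  have ht0 : 0 ≤ t := div_nonneg (by linarith) hs.le
  have ht1 : t ≤ 1 := (div_le_one hs).2 (by linarith)
  have hts : t * ((y' - y) + (z - z')) = y' - y := div_mul_cancel₀ _ hs.ne'
  have h1 := hD hy hz (sub_nonneg.2 ht1) ht0 (by ring)
  have h2 := hD' hy' hz' (sub_nonneg.2 ht1) ht0 (by ring)
  refine Set.disjoint_left.1 hdisj h1 ?_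
  convert h2 using 1
  ext
  · simp
  · simp only [Prod.smul_mk, Prod.mk_add_mk, smul_eq_mul]
    linarith

theorem exists_mem_interior_over {Q : Set (ℝ × ℝ)} (hQ : Convex ℝ Q) (hint : (interior Q).Nonempty)
    {a b : ℝ × ℝ} (ha : a ∈ Q) (hb : b ∈ Q) {x : ℝ} (hax : a.1 < x) (hxb : x < b.1) :
    ∃ y, (x, y) ∈ interior Q := by
  have hcl : Q ⊆ closure (interior Q) := by
    rw [hQ.closure_interior_eq_closure_of_nonempty_interior hint]
    exact subset_closure
  obtain ⟨a', ha'x, ha'⟩ := mem_closure_iff.1 (hcl ha) {p | p.1 < x}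
    (isOpen_lt continuous_fst continuous_const) hax
  obtain ⟨b', hb'x, hb'⟩ := mem_closure_iff.1 (hcl hb) {p | x < p.1}
    (isOpen_lt continuous_const continuous_fst) hxb
  have hord := (hQ.interior.linear_image (LinearMap.fst ℝ ℝ ℝ)).ordConnected
  obtain ⟨⟨x', y⟩, hp, rfl⟩ := hord.out ⟨a', ha', rfl⟩ ⟨b', hb', rfl⟩
    ⟨le_of_lt ha'x, le_of_lt hb'x⟩
  exact ⟨y, hp⟩

theorem mem_interior_of_between {Q : Set (ℝ × ℝ)} (hQ : Convex ℝ Q) {x y y₀ y' : ℝ}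
    (hy : (x, y) ∈ interior Q) (hy₀ : (x, y₀) ∈ Q) (h : y < y' ∧ y' < y₀ ∨ y₀ < y' ∧ y' < y) :
    (x, y') ∈ interior Q := by
  apply hQ.openSegment_interior_self_subset_interior hy hy₀
  rw [← Prod.image_mk_openSegment_right]
  refine ⟨y', ?_, rfl⟩
  rcases h with h | h
  · rw [openSegment_eq_Ioo (h.1.trans h.2)]
    exact h
  · rw [openSegment_symm, openSegment_eq_Ioo (h.1.trans h.2)]
    exact h

/-- Interior-disjoint convex sets in the plane that share nonvertical segments along the edges of `H`:
two such sets are consecutive for the vertical line through the midpoint of the shared segment. Only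
sets in the same class of `cl` are required to be disjoint. -/
theorem ncard_edgeSet_le_of_planar {V ι : Type*} [Fintype V] (H : SimpleGraph V) (cl : V → ι)
    (Q : V → Set (ℝ × ℝ)) (hconv : ∀ v, Convex ℝ (Q v)) (hbdd : ∀ v, Bornology.IsBounded (Q v))
    (hint : ∀ v, (interior (Q v)).Nonempty)
    (hdisj : ∀ u v, u ≠ v → cl u = cl v → Disjoint (interior (Q u)) (interior (Q v)))
    (hadj : ∀ u v, H.Adj u v → cl u = cl v ∧
      ∃ a b, a.1 < b.1 ∧ a ∈ Q u ∩ Q v ∧ b ∈ Q u ∩ Q v) :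
    H.edgeSet.ncard ≤ 3 * Fintype.card V := by
  classical
  let J : V → Set ℝ := fun v => Prod.fst '' interior (Q v)
  have hJo : ∀ v, IsOpen (J v) := fun v => isOpenMap_fst _ isOpen_interior
  have hJb : ∀ v, Bornology.IsBounded (J v) := fun v =>
    (LipschitzWith.prod_fst.isBounded_image ((hbdd v).subset interior_subset))
  have hJc : ∀ v, IsConnected (J v) := fun v =>
    ⟨(hint v).image _, ((hconv v).interior.isPreconnected.image _ continuous_fst.continuousOn)⟩
  let l : V → ℝ := fun v => sInf (J v)
  let r : V → ℝ := fun v => sSup (J v)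
  have hJ : ∀ v, J v = Set.Ioo (l v) (r v) := by
    intro v
    refine Set.Subset.antisymm ?_
      ((hJc v).Ioo_csInf_csSup_subset (hJb v).bddBelow (hJb v).bddAbove)
    have hsub : J v ⊆ Set.Icc (l v) (r v) :=
      subset_Icc_csInf_csSup (hJb v).bddBelow (hJb v).bddAbove
    rw [← interior_Icc]
    exact interior_maximal hsub (hJo v)
  have hmemJ : ∀ v x, (∃ y, (x, y) ∈ interior (Q v)) ↔ l v < x ∧ x < r v := by
    intro v x
    rw [← Set.mem_Ioo, ← hJ v]
    constructor
    · rintro ⟨y, hy⟩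
      exact ⟨(x, y), hy, rfl⟩
    · rintro ⟨⟨x', y⟩, hy, rfl⟩
      exact ⟨y, hy⟩
  let lt : V → V → Prop := fun u v => u ≠ v ∧ cl u = cl v ∧
    ∃ x y y', (x, y) ∈ interior (Q u) ∧ (x, y') ∈ interior (Q v) ∧ y < y'
  have hlt : ∀ {u v x y y'}, lt u v → (x, y) ∈ interior (Q u) → (x, y') ∈ interior (Q v) →
      y < y' := by
    rintro u v x y y' ⟨hne, hc, x₀, z, z', hz, hz', hzz⟩ hy hy'
    exact lt_of_lt_of_disjoint (hconv u).interior (hconv v).interior (hdisj u v hne hc) hz hz' hzz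
      hy hy'
  have hcount := ncard_isConsecutive_le l r lt cl
    (by
      intro v
      obtain ⟨⟨x, y⟩, hp⟩ := hint v
      have := (hmemJ v x).1 ⟨y, hp⟩
      linarith)
    (fun u v h => h.2.1)
    (by
      intro u v x hc hne h1 h2 h3 h4
      obtain ⟨y, hy⟩ := (hmemJ u x).2 ⟨h1, h2⟩
      obtain ⟨y', hy'⟩ := (hmemJ v x).2 ⟨h3, h4⟩
      rcases lt_trichotomy y y' with h | h | h
      · exact Or.inl ⟨hne, hc, x, y, y', hy, hy', h⟩
      · subst h
        exact absurd hy' (Set.disjoint_left.1 (hdisj u v hne hc) hy)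
      · exact Or.inr ⟨hne.symm, hc.symm, x, y', y, hy', hy, h⟩)
    (by
      intro u w v x h1 h2 h3 h4 h5 h6 huw hwv
      obtain ⟨y, hy⟩ := (hmemJ u x).2 ⟨h1, h2⟩
      obtain ⟨y', hy'⟩ := (hmemJ w x).2 ⟨h3, h4⟩
      obtain ⟨y'', hy''⟩ := (hmemJ v x).2 ⟨h5, h6⟩
      have hl1 := hlt huw hy hy'
      have hl2 := hlt hwv hy' hy''
      refine ⟨?_, huw.2.1.trans hwv.2.1, x, y, y'', hy, hy'', hl1.trans hl2⟩
      rintro rfl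
      have := hlt hwv hy' hy
      linarith)
  have hnot : ∀ {u v p}, u ≠ v → cl u = cl v → p ∈ interior (Q u) → p ∉ Q v := by
    intro u v p hne hc hp hpv
    have hd := (hdisj u v hne hc).closure_right isOpen_interior
    rw [(hconv v).closure_interior_eq_closure_of_nonempty_interior (hint v)] at hd
    exact Set.disjoint_left.1 hd hp (subset_closure hpv)
  have hcons : ∀ {u v : V} {x y₀ y y' : ℝ}, u ≠ v → cl u = cl v → (x, y₀) ∈ Q u → (x, y₀) ∈ Q v →
      (x, y) ∈ interior (Q u) → (x, y') ∈ interior (Q v) → y < y₀ → y₀ < y' →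
      IsConsecutive l r lt u v := by
    intro u v x y₀ y y' hne hc hcu hcv hy hy' hlty hlty'
    refine ⟨⟨hne, hc, x, y, y', hy, hy', hlty.trans hlty'⟩, x, (hmemJ u x).1 ⟨y, hy⟩,
      (hmemJ v x).1 ⟨y', hy'⟩, ?_⟩
    rintro w hw1 hw2 ⟨huw, hwv⟩
    obtain ⟨z, hz⟩ := (hmemJ w x).2 ⟨hw1, hw2⟩
    have hz1 := hlt huw hy hz
    have hz2 := hlt hwv hz hy'
    rcases lt_trichotomy z y₀ with h | h | h
    · exact Set.disjoint_left.1 (hdisj u w huw.1 huw.2.1)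
        (mem_interior_of_between (hconv u) hy hcu (Or.inl ⟨hz1, h⟩)) hz
    · subst h
      exact hnot huw.1.symm huw.2.1.symm hz hcu
    · exact Set.disjoint_left.1 (hdisj w v hwv.1 hwv.2.1) hz
        (mem_interior_of_between (hconv v) hy' hcv (Or.inr ⟨h, hz2⟩))
  have hadj' : ∀ u v, H.Adj u v → IsConsecutive l r lt u v ∨ IsConsecutive l r lt v u := by
    intro u v huv
    obtain ⟨hc, a, b, hab, ⟨hau, hav⟩, hbu, hbv⟩ := hadj u v huv
    have hne : u ≠ v := huv.ne
    obtain ⟨⟨x, y₀⟩, hp⟩ : ∃ p, midpoint ℝ a b = p := ⟨_, rfl⟩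
    have hx : x = (a.1 + b.1) / 2 := by
      have := congrArg Prod.fst hp
      rw [midpoint_eq_smul_add] at this
      simp at this
      linarith
    have hcu : (x, y₀) ∈ Q u := hp ▸ (hconv u).midpoint_mem hau hbu
    have hcv : (x, y₀) ∈ Q v := hp ▸ (hconv v).midpoint_mem hav hbv
    obtain ⟨y, hy⟩ := exists_mem_interior_over (hconv u) (hint u) hau hbu (x := x)
      (by linarith) (by linarith)
    obtain ⟨y', hy'⟩ := exists_mem_interior_over (hconv v) (hint v) hav hbv (x := x)
      (by linarith) (by linarith)
    have hd := Set.disjoint_left.1 (hdisj u v hne hc)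
    rcases lt_trichotomy y y₀ with h | h | h
    · rcases lt_trichotomy y' y₀ with h' | h' | h'
      · obtain ⟨z, hz, hz₀⟩ := exists_between (max_lt h h')
        rw [max_lt_iff] at hz
        exact absurd (mem_interior_of_between (hconv v) hy' hcv (Or.inl ⟨hz.2, hz₀⟩))
          (hd (mem_interior_of_between (hconv u) hy hcu (Or.inl ⟨hz.1, hz₀⟩)))
      · exact absurd hcu (hnot hne.symm hc.symm (h' ▸ hy'))
      · exact Or.inl (hcons hne hc hcu hcv hy hy' h h')
    · exact absurd hcv (hnot hne hc (h ▸ hy))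
    · rcases lt_trichotomy y' y₀ with h' | h' | h'
      · exact Or.inr (hcons hne.symm hc.symm hcv hcu hy' hy h' h)
      · exact absurd hcu (hnot hne.symm hc.symm (h' ▸ hy'))
      · obtain ⟨z, hz₀, hz⟩ := exists_between (lt_min h h')
        rw [lt_min_iff] at hz
        exact absurd (mem_interior_of_between (hconv v) hy' hcv (Or.inr ⟨hz₀, hz.2⟩))
          (hd (mem_interior_of_between (hconv u) hy hcu (Or.inr ⟨hz₀, hz.1⟩)))
  have hsub : H.edgeSet ⊆ (fun e : V × V => s(e.1, e.2)) ''
      {e : V × V | IsConsecutive l r lt e.1 e.2} := by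
    intro e
    induction e with
    | _ u v =>
      intro huv
      rcases hadj' u v huv with h | h
      · exact ⟨(u, v), h, rfl⟩
      · exact ⟨(v, u), h, Sym2.eq_swap⟩
  exact (Set.ncard_le_ncard hsub).trans ((Set.ncard_image_le).trans hcount)

/-! ### Contacts within a common plane -/

/-- Finitely many planes can be parametrized simultaneously by two linear functionals, the first of
which is nonzero on finitely many given vectors. -/
theorem exists_coordinates {V κ : Type*} [Finite V] [Finite κ] (W : V → Submodule ℝ E3)
    (hW : ∀ v, Module.finrank ℝ (W v) = 2) (d : κ → E3) (hd : ∀ i, d i ≠ 0) :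
    ∃ X Y : E3 →ₗ[ℝ] ℝ, (∀ i, X (d i) ≠ 0) ∧ ∀ v, ∀ w ∈ W v, X w = 0 → Y w = 0 → w = 0 := by
  have hne : ∀ v, ∃ w ∈ W v, w ≠ 0 := by
    intro v
    apply (W v).exists_mem_ne_zero_of_ne_bot
    rintro h
    have := hW v
    rw [h, finrank_bot] at this
    norm_num at this
  choose w hwW hw using hne
  obtain ⟨X, hX⟩ := Module.exists_dual_forall_apply_ne_zero (K := ℝ) (Sum.elim w d)
    (by rintro (v | i); exacts [hw v, hd i])
  have hker : ∀ v, ∃ n : E3, n ≠ 0 ∧ ∀ w ∈ W v, X w = 0 → ∃ c : ℝ, c • n = w := by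
    intro v
    have hXv : X.comp (W v).subtype ≠ 0 := fun h =>
      hX (Sum.inl v) (by simpa using LinearMap.congr_fun h ⟨w v, hwW v⟩)
    have h1 := Module.Dual.finrank_ker_add_one_of_ne_zero hXv
    rw [hW v] at h1
    obtain ⟨n, hn, hall⟩ := finrank_eq_one_iff'.1 (Nat.succ_injective h1)
    refine ⟨n, by simpa using hn, fun w hw hXw => ?_⟩
    obtain ⟨c, hc⟩ := hall ⟨⟨w, hw⟩, by simpa using hXw⟩
    exact ⟨c, congrArg Subtype.val (congrArg Subtype.val hc)⟩
  choose n hn hall using hker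
  obtain ⟨Y, hY⟩ := Module.exists_dual_forall_apply_ne_zero (K := ℝ) n hn
  refine ⟨X, Y, fun i => hX (Sum.inr i), fun v w hw hXw hYw => ?_⟩
  obtain ⟨c, rfl⟩ := hall v w hw hXw
  rw [map_smul, smul_eq_mul] at hYw
  rw [(mul_eq_zero.1 hYw).resolve_right (hY v), zero_smul]

theorem IsConvexPolygon.convex {P : Set E3} (hP : IsConvexPolygon P) : Convex ℝ P := by
  obtain ⟨⟨S, -, rfl⟩, -⟩ := hP
  exact convex_convexHull ℝ S

theorem IsConvexPolygon.isCompact {P : Set E3} (hP : IsConvexPolygon P) : IsCompact P := by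
  obtain ⟨⟨S, hS, rfl⟩, -⟩ := hP
  exact hS.isCompact_convexHull ℝ

theorem IsConvexPolygon.interior_image_nonempty {P : Set E3} (hP : IsConvexPolygon P)
    (Φ : E3 →ₗ[ℝ] ℝ × ℝ) (hΦ : ∀ w ∈ vectorSpan ℝ P, Φ w = 0 → w = 0) :
    (interior (Φ '' P)).Nonempty := by
  rw [(hP.convex.linear_image Φ).interior_nonempty_iff_affineSpan_eq_top,
    ← AffineSubspace.direction_eq_top_iff_of_nonempty
      ((hP.nonempty.image Φ).mono (subset_affineSpan ℝ _)), direction_affineSpan]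
  have h1 : vectorSpan ℝ (Φ '' P) = (vectorSpan ℝ P).map Φ :=
    (Φ.toAffineMap.map_vectorSpan (s := P)).symm
  rw [h1]
  apply Submodule.eq_top_of_finrank_eq
  have hinj : Function.Injective (Φ.domRestrict (vectorSpan ℝ P)) := by
    rw [← LinearMap.ker_eq_bot, LinearMap.ker_eq_bot']
    intro w hw
    exact Subtype.ext (hΦ w w.2 hw)
  rw [← LinearMap.range_domRestrict, LinearMap.finrank_range_of_inj hinj, hP.2]
  simp

/-- A linear map to the plane that is injective on the plane of `P` detects the relative interior
of `P`. -/
theorem mem_intrinsicInterior_of_image {P : Set E3} {Φ : E3 →ₗ[ℝ] ℝ × ℝ}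
    (hΦ : ∀ w ∈ vectorSpan ℝ P, Φ w = 0 → w = 0) {x : E3} (hx : x ∈ P)
    (hint : Φ x ∈ interior (Φ '' P)) : x ∈ intrinsicInterior ℝ P := by
  rw [mem_intrinsicInterior]
  refine ⟨⟨x, subset_affineSpan ℝ P hx⟩, ?_, rfl⟩
  rw [mem_interior]
  refine ⟨(fun y : affineSpan ℝ P => Φ y) ⁻¹' interior (Φ '' P), ?_, ?_, hint⟩
  · intro y hy
    obtain ⟨p, hp, hpy⟩ := interior_subset hy
    have hmem : p - (y : E3) ∈ vectorSpan ℝ P := by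
      rw [← direction_affineSpan]
      exact AffineSubspace.vsub_mem_direction (mem_affineSpan ℝ hp) y.2
    have := hΦ _ hmem (by rw [map_sub, hpy]; exact sub_self _)
    rw [sub_eq_zero] at this
    change (y : E3) ∈ P
    rwa [← this]
  · exact isOpen_interior.preimage
      (Φ.continuous_of_finiteDimensional.comp continuous_subtype_val)

/-- The graph of those contacts whose two polygons lie in a common plane. -/
def samePlaneGraph {V : Type*} (G : SimpleGraph V) (P : V → Set E3) : SimpleGraph V where
  Adj u v := G.Adj u v ∧ affineSpan ℝ (P u) = affineSpan ℝ (P v)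
  symm := ⟨fun _ _ h => ⟨h.1.symm, h.2.symm⟩⟩
  loopless := ⟨fun _ h => h.1.ne rfl⟩

theorem IsSideContactRep.ncard_samePlaneGraph_le {V : Type*} [Fintype V] {G : SimpleGraph V}
    {P : V → Set E3} (h : IsSideContactRep G P) :
    (samePlaneGraph G P).edgeSet.ncard ≤ 3 * Fintype.card V := by
  have hseg : ∀ e : {e : V × V // G.Adj e.1 e.2}, ∃ a b : E3, a ≠ b ∧
      (a ∈ P e.1.1 ∧ a ∈ P e.1.2) ∧ b ∈ P e.1.1 ∧ b ∈ P e.1.2 := by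
    rintro ⟨⟨u, v⟩, huv⟩
    obtain ⟨s, ⟨⟨a, b, hab, rfl⟩, hu⟩, -, hv⟩ := (h.adj_iff u v huv.ne).1 huv
    have ha := left_mem_segment ℝ a b
    have hb := right_mem_segment ℝ a b
    exact ⟨a, b, hab, ⟨hu.subset ha, hv.subset ha⟩, hu.subset hb, hv.subset hb⟩
  choose a b hab ha hb using hseg
  obtain ⟨X, Y, hX, hXY⟩ := exists_coordinates (fun v => vectorSpan ℝ (P v))
    (fun v => (h.convexPolygon v).2) (fun e => b e - a e) (fun e => sub_ne_zero.2 (hab e).symm)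
  let Φ : E3 →ₗ[ℝ] ℝ × ℝ := X.prod Y
  have hΦ : ∀ v, ∀ w ∈ vectorSpan ℝ (P v), Φ w = 0 → w = 0 := fun v w hw h0 =>
    hXY v w hw (congrArg Prod.fst h0) (congrArg Prod.snd h0)
  refine ncard_edgeSet_le_of_planar _ (fun v => affineSpan ℝ (P v)) (fun v => Φ '' P v)
    (fun v => (h.convexPolygon v).convex.linear_image Φ)
    (fun v => ((h.convexPolygon v).isCompact.image
      Φ.continuous_of_finiteDimensional).isBounded)
    (fun v => (h.convexPolygon v).interior_image_nonempty Φ (hΦ v)) ?_ ?_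
  · intro u v hne hcl
    rw [Set.disjoint_left]
    intro z hzu hzv
    obtain ⟨p, hp, rfl⟩ := interior_subset hzu
    obtain ⟨q, hq, hqp⟩ := interior_subset hzv
    have hmem : q - p ∈ vectorSpan ℝ (P u) := by
      rw [← direction_affineSpan]
      refine AffineSubspace.vsub_mem_direction ?_ (mem_affineSpan ℝ hp)
      exact hcl ▸ mem_affineSpan ℝ hq
    have h0 := hΦ u _ hmem (by rw [map_sub, hqp, sub_self])
    rw [sub_eq_zero] at h0
    subst h0
    exact Set.disjoint_left.1 (h.interiorDisjoint u v hne)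
      (mem_intrinsicInterior_of_image (hΦ u) hp hzu) (mem_intrinsicInterior_of_image (hΦ v) hq hzv)
  · rintro u v ⟨huv, hcl⟩
    refine ⟨hcl, ?_⟩
    have hXe := hX ⟨(u, v), huv⟩
    have hau := ha ⟨(u, v), huv⟩
    have hbu := hb ⟨(u, v), huv⟩
    generalize a ⟨(u, v), huv⟩ = a' at *
    generalize b ⟨(u, v), huv⟩ = b' at *
    have ha' : Φ a' ∈ Φ '' P u ∩ Φ '' P v := ⟨⟨a', hau.1, rfl⟩, ⟨a', hau.2, rfl⟩⟩
    have hb' : Φ b' ∈ Φ '' P u ∩ Φ '' P v := ⟨⟨b', hbu.1, rfl⟩, ⟨b', hbu.2, rfl⟩⟩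
    rw [map_sub, sub_ne_zero] at hXe
    rcases lt_or_gt_of_ne hXe with hlt | hlt
    · exact ⟨_, _, hlt, hb', ha'⟩
    · exact ⟨_, _, hlt, ha', hb'⟩

end SideContact

theorem corollary1 :
    ∃ C : ℝ, 0 < C ∧ ∀ (V : Type*) [Fintype V] (G : SimpleGraph V),
      SideContact.HasSideContactRep G →
        (G.edgeSet.ncard : ℝ) ≤ C * (Fintype.card V : ℝ) ^ ((5 : ℝ) / 3) := by
  classical
  -- `(2 * e) ^ 3 ≤ 131 * n ^ 5 ≤ (6 * n ^ (5 / 3)) ^ 3` gives at most `3 * n ^ (5 / 3)` contacts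
  -- between different planes, and there are at most `3 * n ≤ 3 * n ^ (5 / 3)` others
  refine ⟨6, by norm_num, fun V _ G => ?_⟩
  rintro ⟨P, h⟩
  set n := Fintype.card V with hn
  set K := SideContact.crossPlaneGraph G P
  have h1 := SideContact.card_edgeFinset_cube_le K 128
    fun x y z hxy hxz hyz => h.card_common_neighbors_le hxy hxz hyz
  have h2 := h.ncard_samePlaneGraph_le
  have hsub : G.edgeSet ⊆ K.edgeSet ∪ (SideContact.samePlaneGraph G P).edgeSet := by
    intro e
    induction e with
    | _ u v =>
      intro huv
      by_cases hcl : affineSpan ℝ (P u) = affineSpan ℝ (P v)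
      · exact Or.inr ⟨huv, hcl⟩
      · exact Or.inl ⟨huv, hcl⟩
  have h3 : G.edgeSet.ncard ≤ K.edgeFinset.card + 3 * n := by
    have := (Set.ncard_le_ncard hsub).trans (Set.ncard_union_le _ _)
    rw [← SimpleGraph.coe_edgeFinset K, Set.ncard_coe_finset] at this
    omega
  set N : ℝ := (n : ℝ) ^ ((5 : ℝ) / 3) with hN
  have hN0 : 0 ≤ N := by positivity
  have hN3 : N ^ 3 = (n : ℝ) ^ 5 := by
    rw [hN, ← Real.rpow_natCast, ← Real.rpow_mul (by positivity), ← Real.rpow_natCast]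
    norm_num
  have hnN : (n : ℝ) ≤ N := by
    rcases Nat.eq_zero_or_pos n with h0 | hpos
    · rw [h0, Nat.cast_zero]
      exact hN0
    · exact Real.self_le_rpow_of_one_le (by exact_mod_cast hpos) (by norm_num)
  have h4 : (2 * (K.edgeFinset.card : ℝ)) ≤ 6 * N := by
    apply le_of_pow_le_pow_left₀ (n := 3) (by norm_num) (by positivity)
    have h1' : (2 * (K.edgeFinset.card : ℝ)) ^ 3 ≤ (128 + 3) * (n : ℝ) ^ 5 := by exact_mod_cast h1
    rw [mul_pow 6 N, hN3]
    nlinarith [show (0 : ℝ) ≤ (n : ℝ) ^ 5 by positivity]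
  have h5 : (G.edgeSet.ncard : ℝ) ≤ K.edgeFinset.card + 3 * n := by exact_mod_cast h3
  linarith
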